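/- Consider scheduling with uncertain processing times on $m\ge 1$ identical parallel machines. There are $n$ jobs, all available at time $0$; job $j$ has a testing time $t_j\ge 0$, an upper limit $u_j$ and a real processing time $p_j\in[0,u_j]$. A job is either executed untested, in $u_j$ time units, or tested, in $t_j$ time units, and later executed in $p_j$ time units (possibly on another machine, and with tasks of other jobs in between). Tasks are not preempted, a machine runs one task at a time, and the objective is the sum of the completion times of all jobs. An online algorithm knows $n$ and all $t_j,u_j$ from the start, and learns $p_j$ only when it finishes a test of $j$; $\mathrm{OPT}$ is the minimum cost of a schedule chosen with full knowledge of all $p_j$. An algorithm is $\rho$-competitive if its cost is at most $\rho\cdot\mathrm{OPT}$ on every instance considered. **Theorem.** For every $m\ge 1$ and every $\alpha\ge 1$ there is a deterministic online algorithm that, on the instances in which all testing times are equal, is $\rho_m(\alpha)$-competitive, where $$\rho_m(\alpha)=\max\Big\{2,\alpha,1+\frac2\alpha\Big\}\Big(\frac12+\frac1{2m}\Big)+\max\Big\{\alpha,1+\frac1\alpha\Big\}\Big(1-\frac1m\Big).$$ On these instances the algorithm tests job $j$ if and only if $u_j\ge\alpha t_j$, and it runs greedy list scheduling (a machine never idles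 while a task is available, and always starts the first available task of the list) with the following list: first the untested jobs in non-decreasing order of $u_j$, then all tests, then the executions of the tested jobs in non-decreasing order of $p_j$. The execution of a tested job is available once its test is finished, and every other task is available from time $0$. Moreover, with the best choice of $\alpha$ the ratio tends to $\frac12+\sqrt5=2.73606\ldots$ as $m\to\infty$: $\lim_{m\to\infty}\inf_{\alpha\ge1}\rho_m(\alpha)=\frac12+\sqrt5$, and this limit is also attained with the fixed choice $\alpha=\frac{1+\sqrt5}2$, that is, $\lim_{m\to\infty}\rho_m\big(\frac{1+\sqrt5}2\big)=\frac12+\sqrt5$. Here $2.73606<\frac12+\sqrt5<2.73607$. -/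

import Mathlib

/-! Scheduling with explorable (uncertain) processing times on identical parallel machines. -/

namespace SEU

/-- `n` jobs; job `j` has testing time `t j`, upper limit `u j`, real processing time `p j`. -/
structure Instance (n : ℕ) where
  t : Fin n → ℝ
  u : Fin n → ℝ
  p : Fin n → ℝ
  t_nonneg : ∀ j, 0 ≤ t j
  p_nonneg : ∀ j, 0 ≤ p j
  p_le_u : ∀ j, p j ≤ u j

/-- All testing times are equal. -/
def Instance.Uniform {n : ℕ} (I : Instance n) : Prop := ∀ i j, I.t i = I.t j

/-- `exec j` is the execution of job `j`: the execution-untested task if the schedule at hand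
does not test `j`, the execution after the test otherwise. -/
inductive Task (n : ℕ) where
  | test (j : Fin n) : Task n
  | exec (j : Fin n) : Task n

/-- Which jobs are tested, and when and on which of the `m` machines each task starts.
The values at `test j` are meaningless if `j` is not tested. -/
structure Schedule (n m : ℕ) where
  tested : Fin n → Bool
  start : Task n → ℝ
  machine : Task n → Fin m

namespace Schedule

variable {n m : ℕ}

/-- The tasks that actually occur in the schedule. -/
def Occurs (S : Schedule n m) : Task n → Prop
  | .test j => S.tested j = true
  | .exec _ => True

/-- The length of a task. -/
def dur (I : Instance n) (S : Schedule n m) : Task n → ℝ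
  | .test j => I.t j
  | .exec j => if S.tested j = true then I.p j else I.u j

/-- The time at which a task is finished. -/
def finish (I : Instance n) (S : Schedule n m) (x : Task n) : ℝ := S.start x + S.dur I x

/-- The time from which a task may be started: the execution of a tested job is available once
the test is finished, every other task is available at time `0`. -/
def avail (I : Instance n) (S : Schedule n m) : Task n → ℝ
  | .test _ => 0
  | .exec j => if S.tested j = true then S.finish I (.test j) else 0

/-- Non-preemptive schedules: no task starts before it is available, and a machine runs at most
one task at a time. The test and the execution of a job need not be on the same machine, and
other tasks may be run between them. -/
structure Feasible (I : Instance n) (S : Schedule n m) : Prop where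
  start_nonneg : ∀ x, S.Occurs x → 0 ≤ S.start x
  avail_le_start : ∀ x, S.Occurs x → S.avail I x ≤ S.start x
  no_overlap : ∀ x y, S.Occurs x → S.Occurs y → x ≠ y → S.machine x = S.machine y →
    S.finish I x ≤ S.start y ∨ S.finish I y ≤ S.start x

/-- Total completion time. -/
noncomputable def cost (I : Instance n) (S : Schedule n m) : ℝ := ∑ j, S.finish I (.exec j)

/-- `x` occurs in `S` and is started at time `τ` or earlier. -/
def StartedBy (S : Schedule n m) (τ : ℝ) (x : Task n) : Prop := S.Occurs x ∧ S.start x ≤ τ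

/-- The two schedules have made the same decisions up to and including time `τ`: they have
started the same tasks, at the same times, on the same machines, and they have executed the same
jobs untested. -/
def AgreeUpTo (τ : ℝ) (S S' : Schedule n m) : Prop :=
  (∀ x, S.StartedBy τ x ↔ S'.StartedBy τ x) ∧
  (∀ x, S.StartedBy τ x → S.start x = S'.start x ∧ S.machine x = S'.machine x) ∧
  (∀ j, S.StartedBy τ (.exec j) → S.tested j = S'.tested j)

/-- The place of a task in the list: executions of untested jobs, then tests, then executions of
tested jobs. -/
def phase (S : Schedule n m) : Task n → ℕ
  | .test _ => 1
  | .exec j => if S.tested j = true then 2 else 0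

/-- `x` comes before `y` in the list: earlier phase, or same phase and shorter. -/
def Precedes (I : Instance n) (S : Schedule n m) (x y : Task n) : Prop :=
  S.phase x < S.phase y ∨ (S.phase x = S.phase y ∧ S.dur I x < S.dur I y)

/-- Some task is running on machine `i` at time `τ`. -/
def Busy (I : Instance n) (S : Schedule n m) (i : Fin m) (τ : ℝ) : Prop :=
  ∃ y, S.Occurs y ∧ S.machine y = i ∧ S.start y ≤ τ ∧ τ < S.finish I y

/-- `S` tests exactly the jobs with `α * t j ≤ u j`, and it is a list schedule for the list
"untested jobs in order of `u`, then all tests, then the executions of the tested jobs in order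
of `p`": no machine is idle while a task is available, and whenever a task is started, every
available task that precedes it in the list has been started. -/
structure IsThreePhase (α : ℝ) (I : Instance n) (S : Schedule n m) : Prop where
  feasible : S.Feasible I
  tested_iff : ∀ j, S.tested j = true ↔ α * I.t j ≤ I.u j
  greedy : ∀ x, S.Occurs x → ∀ τ, S.avail I x ≤ τ → τ < S.start x → ∀ i, S.Busy I i τ
  priority : ∀ x y, S.Occurs x → S.Occurs y → S.Precedes I x y → S.avail I x ≤ S.start y →
    S.start x ≤ S.start y

end Schedule

/-- The optimal offline cost on `m` machines. -/
noncomputable def opt {n : ℕ} (m : ℕ) (I : Instance n) : ℝ :=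
  sInf {c : ℝ | ∃ S : Schedule n m, S.Feasible I ∧ c = S.cost I}

/-- A deterministic online algorithm for `m` machines. It knows `n`, `t` and `u` from the start;
a value `p j` may influence only decisions taken at or after the time at which the algorithm
finishes the test of `j`. -/
structure OnlineAlgorithm (m : ℕ) where
  schedule : ∀ {n : ℕ}, Instance n → Schedule n m
  feasible : ∀ {n : ℕ} (I : Instance n), (schedule I).Feasible I
  nonanticipating : ∀ {n : ℕ} (I I' : Instance n) (τ : ℝ), I.t = I'.t → I.u = I'.u →
    (∀ j, (schedule I).tested j = true → (schedule I).finish I (.test j) ≤ τ → I.p j = I'.p j) →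
    Schedule.AgreeUpTo τ (schedule I) (schedule I')

/-- `A` is `ρ`-competitive for total completion time on the instances with uniform testing
times. -/
def OnlineAlgorithm.IsCompetitiveOnUniform {m : ℕ} (A : OnlineAlgorithm m) (ρ : ℝ) : Prop :=
  ∀ (n : ℕ) (I : Instance n), I.Uniform → (A.schedule I).cost I ≤ ρ * opt m I

/-- `max{2, α, 1+2/α} (1/2 + 1/(2m)) + max{α, 1+1/α} (1 - 1/m)` -/
noncomputable def ratio (α : ℝ) (m : ℕ) : ℝ :=
  max 2 (max α (1 + 2 / α)) * (1 / 2 + 1 / (2 * (m : ℝ))) +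
    max α (1 + 1 / α) * (1 - 1 / (m : ℝ))

end SEU

open MeasureTheory in
/-- Integrating an inequality between two weighted sums of indicators of intervals. -/
theorem sum_mul_length_le {ι κ : Type*} (s : Finset ι) (s' : Finset κ) (w a b : ι → ℝ)
    (v c d : κ → ℝ) (hab : ∀ i ∈ s, a i ≤ b i) (hcd : ∀ i ∈ s', c i ≤ d i)
    (h : ∀ τ, ∑ i ∈ s, (if a i ≤ τ ∧ τ < b i then w i else 0) ≤
      ∑ i ∈ s', (if c i ≤ τ ∧ τ < d i then v i else 0)) :
    ∑ i ∈ s, w i * (b i - a i) ≤ ∑ i ∈ s', v i * (d i - c i) := by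
  have hint : ∀ a b w : ℝ, Integrable (fun τ : ℝ => if a ≤ τ ∧ τ < b then w else 0) := by
    intro a b w
    have : (fun τ : ℝ => if a ≤ τ ∧ τ < b then w else 0) =
        (Set.Ico a b).indicator (fun _ => w) := by
      ext τ; simp [Set.indicator_apply]
    rw [this, integrable_indicator_iff measurableSet_Ico]
    exact integrableOn_const (by simp)
  have hval : ∀ a b w : ℝ, a ≤ b → ∫ τ : ℝ, (if a ≤ τ ∧ τ < b then w else 0) = w * (b - a) := by
    intro a b w hab
    have : (fun τ : ℝ => if a ≤ τ ∧ τ < b then w else 0) =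
        (Set.Ico a b).indicator (fun _ => w) := by
      ext τ; simp [Set.indicator_apply]
    rw [this, integral_indicator_const w measurableSet_Ico, Real.volume_real_Ico_of_le hab,
      smul_eq_mul, mul_comm]
  have key := integral_mono (integrable_finsetSum s fun i _ => hint (a i) (b i) (w i))
    (integrable_finsetSum s' fun i _ => hint (c i) (d i) (v i)) h
  rw [integral_finsetSum _ fun i _ => hint _ _ _, integral_finsetSum _ fun i _ => hint _ _ _]
    at key
  rwa [Finset.sum_congr rfl fun i hi => hval _ _ _ (hab i hi),
    Finset.sum_congr rfl fun i hi => hval _ _ _ (hcd i hi)] at key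

/-- In a sum over a total, antisymmetric relation, each unordered pair is counted once. -/
theorem two_mul_sum_sum_ite_total {ι : Type*} [DecidableEq ι] (s : Finset ι) (le : ι → ι → Prop)
    [DecidableRel le] (total : ∀ i j, le i j ∨ le j i) (antisymm : ∀ i j, le i j → le j i → i = j)
    (f : ι → ι → ℝ) (hf : ∀ i j, f i j = f j i) :
    2 * ∑ i ∈ s, ∑ j ∈ s, (if le i j then f i j else 0) =
      ∑ i ∈ s, ∑ j ∈ s, f i j + ∑ i ∈ s, f i i := by
  have h1 : ∑ i ∈ s, ∑ j ∈ s, (if le i j then f i j else 0) =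
      ∑ i ∈ s, ∑ j ∈ s, (if le j i then f i j else 0) := by
    rw [Finset.sum_comm]
    simp only [hf]
  have h2 : ∀ i j, (if le i j then f i j else 0) + (if le j i then f i j else 0) =
      f i j + if i = j then f i j else 0 := by
    intro i j
    by_cases e : i = j
    · subst e
      have := total i i
      simp_all
    · rcases total i j with h | h
      · have h' : ¬ le j i := fun h' => e (antisymm i j h h')
        simp [h, h', e]
      · have h' : ¬ le i j := fun h' => e (antisymm i j h' h)
        simp [h, h', e]
  rw [two_mul]
  nth_rewrite 2 [h1]
  simp only [← Finset.sum_add_distrib, h2]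
  refine Finset.sum_congr rfl fun i hi => ?_
  rw [Finset.sum_add_distrib, Finset.sum_ite_eq]
  simp [hi]

namespace SEU

namespace Task

variable {n : ℕ}

def equivSum (n : ℕ) : Task n ≃ Fin n ⊕ Fin n where
  toFun
    | test j => .inl j
    | exec j => .inr j
  invFun
    | .inl j => test j
    | .inr j => exec j
  left_inv x := by cases x <;> rfl
  right_inv x := by cases x <;> rfl

instance : DecidableEq (Task n) := (equivSum n).decidableEq

instance : Fintype (Task n) := Fintype.ofEquiv _ (equivSum n).symm

theorem sum_eq (f : Task n → ℝ) : ∑ x, f x = ∑ j, f (test j) + ∑ j, f (exec j) := by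
  rw [← (equivSum n).symm.sum_comp, Fintype.sum_sum_type]
  rfl

/-- The job to which a task belongs. -/
def job : Task n → Fin n
  | test j => j
  | exec j => j

@[simp] theorem job_test (j : Fin n) : (test j).job = j := rfl

@[simp] theorem job_exec (j : Fin n) : (exec j).job = j := rfl

end Task

/-- The length of a job for an offline algorithm. -/
def Instance.offline {n : ℕ} (I : Instance n) (j : Fin n) : ℝ := min (I.u j) (I.t j + I.p j)

theorem Instance.u_nonneg {n : ℕ} (I : Instance n) (j : Fin n) : 0 ≤ I.u j :=
  (I.p_nonneg j).trans (I.p_le_u j)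

theorem Instance.offline_nonneg {n : ℕ} (I : Instance n) (j : Fin n) : 0 ≤ I.offline j :=
  le_min (I.u_nonneg j) (add_nonneg (I.t_nonneg j) (I.p_nonneg j))

namespace Schedule

variable {n m : ℕ} {I : Instance n} {S : Schedule n m}

theorem dur_nonneg (I : Instance n) (S : Schedule n m) (x : Task n) : 0 ≤ S.dur I x := by
  cases x with
  | test j => exact I.t_nonneg j
  | exec j =>
    simp only [dur]
    split_ifs
    exacts [I.p_nonneg j, I.u_nonneg j]

theorem start_le_finish (I : Instance n) (S : Schedule n m) (x : Task n) :
    S.start x ≤ S.finish I x := le_add_of_nonneg_right (S.dur_nonneg I x)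

/-- `x` is being run at time `τ`. -/
def Running (I : Instance n) (S : Schedule n m) (τ : ℝ) (x : Task n) : Prop :=
  S.Occurs x ∧ S.start x ≤ τ ∧ τ < S.finish I x

theorem Feasible.eq_of_running (hS : S.Feasible I) {τ : ℝ} {x y : Task n} (hx : S.Running I τ x)
    (hy : S.Running I τ y) (h : S.machine x = S.machine y) : x = y := by
  by_contra hne
  rcases hS.no_overlap x y hx.1 hy.1 hne h with h' | h'
  · linarith [hx.2.2, hy.2.1]
  · linarith [hy.2.2, hx.2.1]

theorem Feasible.finish_test_le (hS : S.Feasible I) {j : Fin n} (hj : S.tested j = true) :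
    S.finish I (.test j) ≤ S.start (.exec j) := by
  simpa [avail, hj] using hS.avail_le_start (.exec j) trivial

theorem Feasible.not_running_test_exec (hS : S.Feasible I) {τ : ℝ} {j : Fin n}
    (h : S.Running I τ (.test j)) (h' : S.Running I τ (.exec j)) : False := by
  have := hS.finish_test_le (j := j) h.1
  linarith [h.2.2, h'.2.1]

theorem Feasible.eq_of_running_of_job (hS : S.Feasible I) {τ : ℝ} {x y : Task n}
    (hx : S.Running I τ x) (hy : S.Running I τ y) (h : x.job = y.job) : x = y := by
  cases x <;> cases y <;> simp only [Task.job_test, Task.job_exec] at h <;> subst h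
  · rfl
  · exact (hS.not_running_test_exec hx hy).elim
  · exact (hS.not_running_test_exec hy hx).elim
  · rfl

theorem Feasible.finish_le_finish_exec (hS : S.Feasible I) {x : Task n} (hx : S.Occurs x) :
    S.finish I x ≤ S.finish I (.exec x.job) := by
  cases x with
  | test j => exact (hS.finish_test_le hx).trans (S.start_le_finish I _)
  | exec j => exact le_rfl

theorem Feasible.offline_le_finish (hS : S.Feasible I) (j : Fin n) :
    I.offline j ≤ S.finish I (.exec j) := by
  by_cases hj : S.tested j = true
  · have h1 := hS.finish_test_le hj
    have h2 := hS.start_nonneg (.test j) hj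
    refine (min_le_right _ _).trans ?_
    simp only [finish, dur, hj, if_true] at h1 ⊢
    linarith
  · refine (min_le_left _ _).trans ?_
    have h2 := hS.start_nonneg (.exec j) trivial
    simp only [finish, dur, hj]
    simpa using h2

theorem Feasible.sum_offline_le_cost (hS : S.Feasible I) : ∑ j, I.offline j ≤ S.cost I :=
  Finset.sum_le_sum fun j _ => hS.offline_le_finish j

theorem sum_card_le_of_total {ι : Type*} [DecidableEq ι] {B N : Finset ι} (hBN : B ⊆ N) {m : ℕ}
    (hm : B.card ≤ m) (le : ι → ι → Prop) [DecidableRel le] (total : ∀ i j, le i j ∨ le j i)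
    (antisymm : ∀ i j, le i j → le j i → i = j) :
    ∑ i ∈ B, (∑ j ∈ N, (if le i j then (1 : ℝ) else 0) + ((m : ℝ) - 1) / 2) ≤ m * N.card := by
  have h1 := two_mul_sum_sum_ite_total B le total antisymm (fun _ _ => 1) (fun _ _ => rfl)
  have h2 : ∑ i ∈ B, ∑ j ∈ N \ B, (if le i j then (1 : ℝ) else 0) ≤
      B.card * ((N.card : ℝ) - B.card) := by
    have : ((N \ B).card : ℝ) = (N.card : ℝ) - B.card := by
      rw [Finset.card_sdiff_of_subset hBN, Nat.cast_sub (Finset.card_le_card hBN)]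
    rw [← this]
    calc _ ≤ ∑ i ∈ B, ∑ j ∈ N \ B, (1 : ℝ) :=
          Finset.sum_le_sum fun i _ => Finset.sum_le_sum fun j _ => by split_ifs <;> norm_num
      _ = _ := by simp
  have h3 : ∀ i, ∑ j ∈ N, (if le i j then (1 : ℝ) else 0) =
      ∑ j ∈ N \ B, (if le i j then (1 : ℝ) else 0) + ∑ j ∈ B, (if le i j then (1 : ℝ) else 0) :=
    fun i => (Finset.sum_sdiff hBN).symm
  simp only [h3, Finset.sum_add_distrib]
  simp only [Finset.sum_const, nsmul_eq_mul, mul_one] at h1 ⊢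
  have hb : (B.card : ℝ) ≤ m := by exact_mod_cast hm
  have hn : (B.card : ℝ) ≤ N.card := by exact_mod_cast Finset.card_le_card hBN
  have h0 : (0 : ℝ) ≤ B.card := by positivity
  nlinarith [mul_nonneg (sub_nonneg.2 hb) (sub_nonneg.2 hn), mul_nonneg (sub_nonneg.2 hb) h0]

/-- The Eastman–Even–Isaacs lower bound, for schedules in which the test and the execution of a
job need not be on the same machine. -/
theorem Feasible.eastman_even_isaacs (hS : S.Feasible I) (hm : 1 ≤ m) :
    (m : ℝ) / 2 * ∑ j, I.offline j + 1 / 2 * ∑ i, ∑ j, min (I.offline i) (I.offline j) ≤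
      m * S.cost I := by
  classical
  let C : Fin n → ℝ := fun j => S.finish I (.exec j)
  let le : Fin n → Fin n → Prop := fun i j => C i < C j ∨ (C i = C j ∧ i ≤ j)
  have total : ∀ i j, le i j ∨ le j i := by
    intro i j
    rcases lt_trichotomy (C i) (C j) with h | h | h
    · exact .inl (.inl h)
    · rcases le_total i j with h' | h'
      · exact .inl (.inr ⟨h, h'⟩)
      · exact .inr (.inr ⟨h.symm, h'⟩)
    · exact .inr (.inl h)
  have antisymm : ∀ i j, le i j → le j i → i = j := by
    rintro i j (h | ⟨h, h1⟩) (h' | ⟨h', h1'⟩)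
    · exact absurd h' h.not_gt
    · exact absurd h' h.ne'
    · exact absurd h h'.ne'
    · exact le_antisymm h1 h1'
  let w : Fin n → ℝ := fun i => ∑ j, (if le i j then (1 : ℝ) else 0) + ((m : ℝ) - 1) / 2
  have hm1 : (1 : ℝ) ≤ m := by exact_mod_cast hm
  have hw : ∀ i, 0 ≤ w i := fun i =>
    add_nonneg (Finset.sum_nonneg fun j _ => by split_ifs <;> norm_num) (by linarith)
  have hC : ∀ j, 0 ≤ C j := fun j => (I.offline_nonneg j).trans (hS.offline_le_finish j)
  have step := sum_mul_length_le (Finset.univ.filter S.Occurs) Finset.univ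
    (fun x => w x.job) S.start (S.finish I) (fun _ => (m : ℝ)) (fun _ => 0) C
    (fun x _ => S.start_le_finish I x) (fun j _ => hC j) (by
      intro τ
      rw [← Finset.sum_filter, ← Finset.sum_filter, Finset.filter_filter]
      set A := Finset.univ.filter
        (fun x => S.Occurs x ∧ S.start x ≤ τ ∧ τ < S.finish I x) with hA
      set N := Finset.univ.filter (fun j => 0 ≤ τ ∧ τ < C j) with hN
      have hAr : ∀ x ∈ A, S.Running I τ x := fun x hx => (Finset.mem_filter.1 hx).2
      have hAN : ∀ x ∈ A, x.job ∈ N := fun x hx => by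
        have h := hAr x hx
        exact Finset.mem_filter.2 ⟨Finset.mem_univ _, (hS.start_nonneg x h.1).trans h.2.1,
          h.2.2.trans_le (hS.finish_le_finish_exec h.1)⟩
      have hinj : Set.InjOn Task.job (A : Set (Task n)) := fun x hx y hy h =>
        hS.eq_of_running_of_job (hAr x hx) (hAr y hy) h
      have hcard : (A.image Task.job).card ≤ m := by
        rw [Finset.card_image_of_injOn hinj]
        simpa using Finset.card_le_card_of_injOn S.machine
          (fun x _ => Finset.mem_coe.2 (Finset.mem_univ (S.machine x)))
          (fun x hx y hy h => hS.eq_of_running (hAr x hx) (hAr y hy) h)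
      have hsub : A.image Task.job ⊆ N := by
        intro j hj
        obtain ⟨x, hx, rfl⟩ := Finset.mem_image.1 hj
        exact hAN x hx
      have := sum_card_le_of_total hsub hcard le total antisymm
      rw [Finset.sum_image hinj] at this
      rw [Finset.sum_const, nsmul_eq_mul, mul_comm (N.card : ℝ)]
      refine le_trans (le_of_eq ?_) this
      refine Finset.sum_congr rfl fun x hx => ?_
      simp only [w]
      congr 1
      refine (Finset.sum_subset (Finset.subset_univ N) fun j _ hj => if_neg ?_).symm
      intro hle
      apply hj
      have hxN := (Finset.mem_filter.1 (hAN x hx)).2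
      refine Finset.mem_filter.2 ⟨Finset.mem_univ _, hxN.1, hxN.2.trans_le ?_⟩
      rcases hle with h | h
      exacts [h.le, h.1.le])
  have hleft : ∑ j, w j * I.offline j ≤
      ∑ x ∈ Finset.univ.filter S.Occurs, w x.job * (S.finish I x - S.start x) := by
    rw [Finset.sum_filter, Task.sum_eq, ← Finset.sum_add_distrib]
    refine Finset.sum_le_sum fun j _ => ?_
    by_cases hj : S.tested j = true
    · simp only [Occurs, hj, finish, dur, if_true, Task.job]
      have := min_le_right (I.u j) (I.t j + I.p j)
      have := mul_le_mul_of_nonneg_left this (hw j)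
      simp only [Instance.offline]
      linarith
    · simp only [Occurs, hj, finish, dur, if_true, Task.job]
      have := min_le_left (I.u j) (I.t j + I.p j)
      have := mul_le_mul_of_nonneg_left this (hw j)
      simp only [Instance.offline]
      simpa using this
  have hpairs := two_mul_sum_sum_ite_total Finset.univ le total antisymm
    (fun i j => min (I.offline i) (I.offline j)) (fun i j => min_comm _ _)
  have hmin : ∑ i, ∑ j, (if le i j then min (I.offline i) (I.offline j) else 0) ≤
      ∑ i, (∑ j, (if le i j then (1 : ℝ) else 0)) * I.offline i := by
    refine Finset.sum_le_sum fun i _ => ?_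
    rw [Finset.sum_mul]
    refine Finset.sum_le_sum fun j _ => ?_
    split_ifs <;> simp
  have hexp : ∑ j, w j * I.offline j = ∑ i, (∑ j, (if le i j then (1 : ℝ) else 0)) * I.offline i +
      ((m : ℝ) - 1) / 2 * ∑ j, I.offline j := by
    rw [Finset.mul_sum, ← Finset.sum_add_distrib]
    exact Finset.sum_congr rfl fun j _ => add_mul _ _ _
  have hright : ∑ j, (m : ℝ) * (C j - 0) = m * S.cost I := by
    simp only [sub_zero, ← Finset.mul_sum]
    rfl
  simp only [min_self] at hpairs
  linarith

end Schedule

end SEU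

namespace SEU

namespace Schedule

variable {n m : ℕ} {I : Instance n} {S : Schedule n m} {α : ℝ}

/-- If all machines run tasks of `W` during `[0, s)`, except possibly during `[a, r)`, then
`m * s` is bounded by the work of `W` and `m * (r - a)`. -/
theorem mul_le_of_busy (W : Finset (Task n)) {s a r : ℝ} (hs : 0 ≤ s) (har : a ≤ r)
    (hbusy : ∀ τ, 0 ≤ τ → τ < s → (a ≤ τ ∧ τ < r) ∨
      ∀ i, ∃ y ∈ W, S.machine y = i ∧ S.start y ≤ τ ∧ τ < S.finish I y) :
    m * s ≤ m * (r - a) + ∑ x ∈ W, S.dur I x := by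
  have hpt : ∀ τ, (if 0 ≤ τ ∧ τ < s then (m : ℝ) else 0) ≤
      ∑ x ∈ W, (if S.start x ≤ τ ∧ τ < S.finish I x then (1 : ℝ) else 0) +
        if a ≤ τ ∧ τ < r then (m : ℝ) else 0 := by
    intro τ
    have h0 : 0 ≤ ∑ x ∈ W, (if S.start x ≤ τ ∧ τ < S.finish I x then (1 : ℝ) else 0) :=
      Finset.sum_nonneg fun x _ => by split_ifs <;> norm_num
    have h1 : (0 : ℝ) ≤ if a ≤ τ ∧ τ < r then (m : ℝ) else 0 := by split_ifs <;> positivity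
    by_cases hτ : 0 ≤ τ ∧ τ < s
    · rw [if_pos hτ]
      obtain h | h := hbusy τ hτ.1 hτ.2
      · rw [if_pos h]
        linarith
      choose y hyW hyi hy using h
      refine le_trans ?_ (le_add_of_nonneg_right h1)
      rw [← Finset.sum_filter, Finset.sum_const, nsmul_eq_mul, mul_one]
      have := Finset.card_le_card_of_injOn (s := Finset.univ)
        (t := W.filter fun x => S.start x ≤ τ ∧ τ < S.finish I x) y
        (fun i _ => Finset.mem_coe.2 (Finset.mem_filter.2 ⟨hyW i, hy i⟩))
        (fun i _ i' _ e => by rw [← hyi i, ← hyi i', e])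
      simp only [Finset.card_univ, Fintype.card_fin] at this
      exact_mod_cast this
    · rw [if_neg hτ]
      linarith
  have key := sum_mul_length_le ({()} : Finset Unit) (W.disjSum ({()} : Finset Unit))
    (fun _ => (m : ℝ)) (fun _ => 0) (fun _ => s) (Sum.elim (fun _ => 1) (fun _ => (m : ℝ)))
    (Sum.elim S.start fun _ => a) (Sum.elim (S.finish I) fun _ => r) (fun _ _ => hs)
    (by
      rintro (x | x) -
      exacts [S.start_le_finish I x, har])
    (by
      intro τ
      rw [Finset.sum_singleton, Finset.sum_disjSum, Finset.sum_singleton]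
      exact hpt τ)
  simp only [Finset.sum_singleton, Finset.sum_disjSum, Sum.elim_inl, Sum.elim_inr, sub_zero,
    one_mul] at key
  have hd : ∑ x ∈ W, S.dur I x = ∑ x ∈ W, (S.finish I x - S.start x) :=
    Finset.sum_congr rfl fun x _ => by simp [finish]
  linarith

namespace IsThreePhase

theorem lt_of_not_tested (h : S.IsThreePhase α I) {j : Fin n} (hj : ¬ S.tested j = true) :
    I.u j < α * I.t j := by
  by_contra hc
  exact hj ((h.tested_iff j).2 (not_lt.1 hc))

theorem start_test_le (h : S.IsThreePhase α I) {i j : Fin n} (hi : S.tested i = true)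
    (hj : S.tested j = true) : S.start (.test i) ≤ S.start (.exec j) := by
  refine h.priority (.test i) (.exec j) hi trivial (.inl (by simp [phase, hj])) ?_
  exact (h.feasible.start_nonneg (.test j) hj).trans
    ((S.start_le_finish I _).trans (h.feasible.finish_test_le hj))

theorem start_untested_le (h : S.IsThreePhase α I) {i j : Fin n} (hi : ¬ S.tested i = true)
    (hj : S.tested j = true) : S.start (.exec i) ≤ S.start (.exec j) := by
  refine h.priority (.exec i) (.exec j) trivial trivial (.inl (by simp [phase, hi, hj])) ?_
  simpa [avail, hi] using h.feasible.start_nonneg (.exec j) trivial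

theorem start_exec_le (h : S.IsThreePhase α I) {i j : Fin n} (hi : S.tested i = true)
    (hj : S.tested j = true) (hp : I.p i < I.p j)
    (ha : S.finish I (.test i) ≤ S.start (.exec j)) : S.start (.exec i) ≤ S.start (.exec j) := by
  refine h.priority (.exec i) (.exec j) trivial trivial (.inr ⟨by simp [phase, hi, hj], ?_⟩) ?_
  · simpa [dur, hi, hj] using hp
  · simpa [avail, hi] using ha

/-- If a longer job has been executed before the test of `j` is finished, then `j` is executed
as soon as its test is finished. -/
theorem start_exec_le_finish_test (h : S.IsThreePhase α I) {i j : Fin n} (hi : S.tested i = true)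
    (hj : S.tested j = true) (hp : I.p j < I.p i)
    (hlt : S.start (.exec i) < S.finish I (.test j)) :
    S.start (.exec j) ≤ S.finish I (.test j) := by
  classical
  by_contra hcon
  push Not at hcon
  let r : Fin n → ℝ := fun k => S.finish I (.test k)
  let B : Finset (Fin n) := Finset.univ.filter fun k => S.tested k = true ∧ I.p k < I.p i ∧
    S.start (.exec i) < r k ∧ r k < S.start (.exec k)
  obtain ⟨k, hkB, hmin⟩ := B.exists_min_image r
    ⟨j, Finset.mem_filter.2 ⟨Finset.mem_univ _, hj, hp, hlt, hcon⟩⟩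
  obtain ⟨-, hk, hkp, hik, hwait⟩ := Finset.mem_filter.1 hkB
  let Z : Finset (Fin n) := Finset.univ.filter fun z => S.tested z = true ∧ r z = r k
  have hkZ : k ∈ Z := Finset.mem_filter.2 ⟨Finset.mem_univ _, hk, rfl⟩
  have hr0 : ∀ z, S.tested z = true → 0 ≤ r z := fun z hz =>
    (h.feasible.start_nonneg (.test z) hz).trans (S.start_le_finish I _)
  have hex : ∀ z ∈ Z, ∃ y ∈ Z, S.machine (.exec y) = S.machine (.test z) ∧
      S.start (.exec y) = r k := by
    intro z hz
    obtain ⟨-, hzt, hzr⟩ := Finset.mem_filter.1 hz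
    obtain ⟨y, hyo, hym, hys, hyf⟩ := h.greedy (.exec k) trivial (r k)
      (by simp [avail, hk, r]) hwait (S.machine (.test z))
    have hne : y ≠ .test z := by
      rintro rfl
      exact absurd hzr hyf.ne'
    have hstart : S.start y = r k := by
      refine le_antisymm hys ?_
      rcases h.feasible.no_overlap y (.test z) hyo hzt hne hym with h' | h'
      · have := S.start_le_finish I (.test z)
        change S.finish I (.test z) = r k at hzr
        linarith
      · exact hzr ▸ h'
    cases y with
    | test y =>
      have := h.start_test_le (j := i) hyo hi
      linarith
    | exec y =>
      by_cases hy : S.tested y = true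
      · have hyr : r y ≤ r k := hstart ▸ h.feasible.finish_test_le hy
        have hyp : I.p y ≤ I.p k := by
          by_contra hc
          have := h.start_exec_le hk hy (not_le.1 hc) hstart.ge
          linarith
        refine ⟨y, Finset.mem_filter.2 ⟨Finset.mem_univ _, hy, le_antisymm hyr ?_⟩, hym, hstart⟩
        by_contra hc
        have hiy : S.start (.exec i) < r y := by
          by_contra hc'
          have := h.start_exec_le hy hi (hyp.trans_lt hkp) (not_lt.1 hc')
          linarith
        exact hc (hmin y (Finset.mem_filter.2 ⟨Finset.mem_univ _, hy, hyp.trans_lt hkp, hiy,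
          hstart ▸ not_le.1 hc⟩))
      · have := h.start_untested_le hy hi
        linarith
  choose! f hfZ hfm hfs using hex
  have hinj : Set.InjOn f (Z : Set (Fin n)) := by
    intro z hz z' hz' e
    have hm : S.machine (.test z) = S.machine (.test z') := by
      rw [← hfm z hz, ← hfm z' hz', e]
    obtain ⟨-, hzt, hzr⟩ := Finset.mem_filter.1 hz
    obtain ⟨-, hzt', hzr'⟩ := Finset.mem_filter.1 hz'
    by_contra hne
    have h1 := h.start_test_le hzt hi
    have h2 := h.start_test_le hzt' hi
    change S.finish I _ = r k at hzr
    change S.finish I _ = r k at hzr'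
    rcases h.feasible.no_overlap (.test z) (.test z') hzt hzt' (by simpa using hne) hm with h' | h'
    <;> linarith
  have hk' : k ∉ Z.image f := by
    intro hmem
    obtain ⟨z, hz, hzk⟩ := Finset.mem_image.1 hmem
    have := hfs z hz
    rw [hzk] at this
    exact absurd this hwait.ne'
  have hss : Z.image f ⊂ Z := by
    refine (Finset.ssubset_iff_of_subset ?_).2 ⟨k, hkZ, hk'⟩
    intro z hz
    obtain ⟨z', hz', rfl⟩ := Finset.mem_image.1 hz
    exact hfZ z' hz'
  have := Finset.card_lt_card hss
  rw [Finset.card_image_of_injOn hinj] at this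
  exact lt_irrefl _ this

end IsThreePhase

open Classical in
/-- The part of the work for job `i` that may delay job `j`. -/
noncomputable def delay (I : Instance n) (S : Schedule n m) (j i : Fin n) : ℝ :=
  if S.tested j = true then
    if S.tested i = true then
      (if i = j then 0 else I.t i) +
        if S.start (.exec i) < S.start (.exec j) ∧ I.p i ≤ I.p j then I.p i else 0
    else I.u i
  else
    if ¬ S.tested i = true ∧ S.start (.exec i) < S.start (.exec j) ∧ I.u i ≤ I.u j then I.u i
    else 0

/-- The total length of the tasks of job `j`. -/
def work (I : Instance n) (S : Schedule n m) (j : Fin n) : ℝ :=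
  if S.tested j = true then I.t j + I.p j else I.u j

namespace IsThreePhase

theorem mul_finish_le_of_not_tested (h : S.IsThreePhase α I) {j : Fin n}
    (hj : ¬ S.tested j = true) :
    m * S.finish I (.exec j) ≤ m * S.work I j + ∑ i, S.delay I j i := by
  classical
  let W : Finset (Task n) := Finset.univ.filter fun
    | .test _ => False
    | .exec i => ¬ S.tested i = true ∧ S.start (.exec i) < S.start (.exec j) ∧ I.u i ≤ I.u j
  have key := mul_le_of_busy (I := I) (S := S) W (a := 0) (r := 0)
    (h.feasible.start_nonneg (.exec j) trivial) le_rfl (by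
      intro τ h0 hτ
      refine .inr fun i => ?_
      obtain ⟨y, hyo, hym, hys, hyf⟩ := h.greedy (.exec j) trivial τ
        (by simpa [avail, hj] using h0) hτ i
      refine ⟨y, Finset.mem_filter.2 ⟨Finset.mem_univ _, ?_⟩, hym, hys, hyf⟩
      have hprec : ¬ S.Precedes I (.exec j) y := fun hp => by
        have := h.priority (.exec j) y trivial hyo hp
          (by simpa [avail, hj] using h.feasible.start_nonneg y hyo)
        linarith
      cases y with
      | test y => exact hprec (.inl (by simp [phase, hj]))
      | exec y =>
        have hy : ¬ S.tested y = true := fun hy => hprec (.inl (by simp [phase, hj, hy]))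
        refine ⟨hy, hys.trans_lt hτ, ?_⟩
        by_contra hc
        exact hprec (.inr ⟨by simp [phase, hj, hy], by simpa [dur, hj, hy] using hc⟩))
  have hW : ∑ x ∈ W, S.dur I x = ∑ i, S.delay I j i := by
    rw [Finset.sum_filter, Task.sum_eq]
    simp only [if_false, Finset.sum_const_zero, zero_add, delay, if_neg hj]
    refine Finset.sum_congr rfl fun i _ => ?_
    split_ifs with h1
    · simp [dur, h1.1]
    · rfl
  have hf : S.finish I (.exec j) = S.start (.exec j) + I.u j := by simp [finish, dur, hj]
  have hw : S.work I j = I.u j := by simp [work, hj]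
  rw [hf, hw, mul_add]
  linarith

theorem mul_finish_le_of_tested (h : S.IsThreePhase α I) {j : Fin n}
    (hj : S.tested j = true) :
    m * S.finish I (.exec j) ≤ m * S.work I j + ∑ i, S.delay I j i := by
  classical
  let W : Finset (Task n) := Finset.univ.filter fun
    | .test i => S.tested i = true ∧ i ≠ j
    | .exec i => ¬ S.tested i = true ∨
        (S.tested i = true ∧ S.start (.exec i) < S.start (.exec j) ∧ I.p i ≤ I.p j)
  have key := mul_le_of_busy (I := I) (S := S) W (a := S.start (.test j))
    (r := S.finish I (.test j))
    (h.feasible.start_nonneg (.exec j) trivial) (S.start_le_finish I _) (by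
      intro τ h0 hτ
      by_cases hin : S.start (.test j) ≤ τ ∧ τ < S.finish I (.test j)
      · exact .inl hin
      refine .inr fun i => ?_
      by_cases hτa : τ < S.start (.test j)
      · obtain ⟨y, hyo, hym, hys, hyf⟩ := h.greedy (.test j) hj τ h0 hτa i
        refine ⟨y, Finset.mem_filter.2 ⟨Finset.mem_univ _, ?_⟩, hym, hys, hyf⟩
        cases y with
        | test y =>
          refine ⟨hyo, ?_⟩
          rintro rfl
          linarith
        | exec y =>
          refine .inl fun hy => ?_
          have := h.start_test_le hj hy
          linarith
      · have hτr : S.finish I (.test j) ≤ τ := by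
          by_contra hc
          exact hin ⟨not_lt.1 hτa, not_le.1 hc⟩
        obtain ⟨y, hyo, hym, hys, hyf⟩ := h.greedy (.exec j) trivial τ
          (by simpa [avail, hj] using hτr) hτ i
        refine ⟨y, Finset.mem_filter.2 ⟨Finset.mem_univ _, ?_⟩, hym, hys, hyf⟩
        cases y with
        | test y =>
          refine ⟨hyo, ?_⟩
          rintro rfl
          linarith
        | exec y =>
          by_cases hy : S.tested y = true
          · refine .inr ⟨hy, hys.trans_lt hτ, ?_⟩
            by_contra hc
            rcases lt_or_ge (S.start (.exec y)) (S.finish I (.test j)) with hlt | hge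
            · have := h.start_exec_le_finish_test hy hj (not_le.1 hc) hlt
              linarith
            · have := h.start_exec_le hj hy (not_le.1 hc) hge
              linarith
          · exact .inl hy)
  have hW : ∑ x ∈ W, S.dur I x = ∑ i, S.delay I j i := by
    rw [Finset.sum_filter, Task.sum_eq, ← Finset.sum_add_distrib]
    refine Finset.sum_congr rfl fun i _ => ?_
    by_cases hi : S.tested i = true <;> by_cases hij : i = j <;> simp [delay, hi, hj, hij, dur]
  have hf : S.finish I (.exec j) = S.start (.exec j) + I.p j := by simp [finish, dur, hj]
  have hf' : S.finish I (.test j) = S.start (.test j) + I.t j := by simp [finish, dur]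
  have hw : S.work I j = I.t j + I.p j := by simp [work, hj]
  rw [hf', add_sub_cancel_left] at key
  rw [hf, hw, mul_add, mul_add]
  linarith

theorem work_le (h : S.IsThreePhase α I) (hα : 1 ≤ α) (j : Fin n) :
    S.work I j ≤ max α (1 + 1 / α) * I.offline j := by
  have hα0 : 0 < α := by linarith
  have hq := I.offline_nonneg j
  have hu := I.u_nonneg j
  have hp := I.p_le_u j
  have hp0 := I.p_nonneg j
  have ht0 := I.t_nonneg j
  by_cases hj : S.tested j = true
  · have ht := (h.tested_iff j).1 hj
    refine le_trans ?_ (mul_le_mul_of_nonneg_right (le_max_right _ _) hq)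
    simp only [work, hj, if_true]
    have h1 : 0 < 1 / α := by positivity
    rcases min_choice (I.u j) (I.t j + I.p j) with e | e <;> rw [Instance.offline, e]
    · have : I.t j ≤ 1 / α * I.u j := by
        rw [one_div, ← div_eq_inv_mul, le_div_iff₀ hα0]
        linarith
      linarith
    · nlinarith
  · have ht := h.lt_of_not_tested hj
    refine le_trans ?_ (mul_le_mul_of_nonneg_right (le_max_left _ _) hq)
    simp only [work, hj]
    rcases min_choice (I.u j) (I.t j + I.p j) with e | e <;> rw [Instance.offline, e]
    · simp only [Bool.false_eq_true, if_false]; nlinarith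
    · simp only [Bool.false_eq_true, if_false]; nlinarith

theorem delay_add_delay_le (h : S.IsThreePhase α I) (hI : I.Uniform) (hα : 1 ≤ α) (i j : Fin n) :
    S.delay I j i + S.delay I i j ≤
      max 2 (max α (1 + 2 / α)) * (min (I.offline i) (I.offline j) -
        if i = j then I.offline j else 0) := by
  have hα0 : 0 < α := by linarith
  set R := max 2 (max α (1 + 2 / α)) with hR
  have hR2 : 2 ≤ R := le_max_left _ _
  have hRα : α ≤ R := (le_max_left _ _).trans (le_max_right _ _)
  have hR1 : 1 + 2 / α ≤ R := (le_max_right _ _).trans (le_max_right _ _)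
  by_cases hij : i = j
  · subst hij
    by_cases hi : S.tested i = true <;> simp [delay, hi]
  rw [if_neg hij, sub_zero]
  have hji : ¬ j = i := fun e => hij e.symm
  have htt : I.t i = I.t j := hI i j
  have hle : ∀ c, c ≤ R * I.offline i → c ≤ R * I.offline j →
      c ≤ R * min (I.offline i) (I.offline j) := by
    intro c h1 h2
    rcases min_choice (I.offline i) (I.offline j) with e | e <;> rwa [e]
  have unt : ∀ k, ¬ S.tested k = true → I.u k ≤ R * I.offline k := by
    intro k hk
    have := h.lt_of_not_tested hk
    have h0 := I.u_nonneg k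
    have h1 := I.p_nonneg k
    have h2 := I.t_nonneg k
    rcases min_choice (I.u k) (I.t k + I.p k) with e | e <;> rw [Instance.offline, e] <;> nlinarith
  have tst : ∀ k, S.tested k = true → α * I.t k ≤ R * I.offline k := by
    intro k hk
    have := (h.tested_iff k).1 hk
    have h0 := I.u_nonneg k
    have h1 := I.p_nonneg k
    have h2 := I.t_nonneg k
    rcases min_choice (I.u k) (I.t k + I.p k) with e | e <;> rw [Instance.offline, e] <;> nlinarith
  have tst2 : ∀ k, S.tested k = true → 2 * I.t k + I.p k ≤ R * I.offline k := by
    intro k hk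
    have := (h.tested_iff k).1 hk
    have h0 := I.u_nonneg k
    have h1 := I.p_nonneg k
    have h2 := I.t_nonneg k
    have h3 := I.p_le_u k
    rcases min_choice (I.u k) (I.t k + I.p k) with e | e <;> rw [Instance.offline, e]
    · have : I.t k ≤ I.u k / α := by
        rw [le_div_iff₀ hα0]
        linarith
      have h4 : (1 + 2 / α) * I.u k ≤ R * I.u k := mul_le_mul_of_nonneg_right hR1 h0
      have h5 : (1 + 2 / α) * I.u k = I.u k + 2 * (I.u k / α) := by ring
      linarith
    · nlinarith
  have hpi := I.p_nonneg i
  have hpj := I.p_nonneg j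
  have hui := I.u_nonneg i
  have huj := I.u_nonneg j
  by_cases hi : S.tested i = true <;> by_cases hj : S.tested j = true
  · have e1 := tst2 i hi
    have e2 := tst2 j hj
    simp only [delay, hi, hj, hij, hji, if_true, if_false]
    apply hle <;> split_ifs with h1 h2 <;> linarith
  · have e1 := tst i hi
    have e2 := unt j hj
    have e3 := h.lt_of_not_tested hj
    rw [← htt] at e3
    simp only [delay, hi, hj]
    apply hle <;> simp <;> linarith
  · have e1 := tst j hj
    have e2 := unt i hi
    have e3 := h.lt_of_not_tested hi
    rw [htt] at e3
    simp only [delay, hi, hj]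
    apply hle <;> simp <;> linarith
  · have e1 := unt i hi
    have e2 := unt j hj
    simp only [delay, if_neg hi, if_neg hj]
    apply hle <;> split_ifs with h1 h2 h2 <;> linarith

theorem cost_le (h : S.IsThreePhase α I) (hI : I.Uniform) (hα : 1 ≤ α) (hm : 1 ≤ m)
    {S' : Schedule n m} (hS' : S'.Feasible I) : S.cost I ≤ ratio α m * S'.cost I := by
  have hα0 : 0 < α := by linarith
  set R := max 2 (max α (1 + 2 / α)) with hR
  set Q := max α (1 + 1 / α) with hQ
  set q := ∑ j, I.offline j with hq
  set D := ∑ i, ∑ j, min (I.offline i) (I.offline j) with hD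
  have hQR : Q ≤ R := by
    refine max_le ((le_max_left _ _).trans (le_max_right _ _)) ?_
    refine le_trans ?_ ((le_max_right _ _).trans (le_max_right _ _))
    gcongr
    norm_num
  have hRQ : R ≤ 2 * Q := by
    have h1 : α ≤ Q := le_max_left _ _
    have h2 : 1 + 1 / α ≤ Q := le_max_right _ _
    refine max_le (by linarith) (max_le (by linarith) ?_)
    have : 2 / α = 2 * (1 / α) := by ring
    linarith
  have hm1 : (1 : ℝ) ≤ m := by exact_mod_cast hm
  have hfin : m * S.cost I ≤ ∑ j, (m * S.work I j + ∑ i, S.delay I j i) := by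
    rw [cost, Finset.mul_sum]
    refine Finset.sum_le_sum fun j _ => ?_
    by_cases hj : S.tested j = true
    exacts [h.mul_finish_le_of_tested hj, h.mul_finish_le_of_not_tested hj]
  have hwork : ∑ j, S.work I j ≤ Q * q := by
    rw [hq, Finset.mul_sum]
    exact Finset.sum_le_sum fun j _ => h.work_le hα j
  have hdelay : 2 * ∑ j, ∑ i, S.delay I j i ≤ R * (D - q) := by
    have e : R * (D - q) = ∑ j, ∑ i, R * (min (I.offline i) (I.offline j) -
        if i = j then I.offline j else 0) := by
      simp only [← Finset.mul_sum, Finset.sum_sub_distrib, Finset.sum_ite_eq', Finset.mem_univ,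
        if_true]
      rw [hD, Finset.sum_comm]
    rw [two_mul, e]
    nth_rewrite 2 [Finset.sum_comm]
    simp only [← Finset.sum_add_distrib]
    exact Finset.sum_le_sum fun j _ => Finset.sum_le_sum fun i _ =>
      h.delay_add_delay_le hI hα i j
  have hopt := hS'.eastman_even_isaacs hm
  have hopt' := hS'.sum_offline_le_cost
  have hq0 : 0 ≤ q := Finset.sum_nonneg fun j _ => I.offline_nonneg j
  rw [Finset.sum_add_distrib, ← Finset.mul_sum] at hfin
  have hR0 : 0 < R := lt_of_lt_of_le two_pos (le_max_left _ _)
  have hmain : m * S.cost I ≤ (R * (m + 1) / 2 + Q * (m - 1)) * S'.cost I := by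
    have a1 : (m : ℝ) * ∑ j, S.work I j ≤ m * (Q * q) :=
      mul_le_mul_of_nonneg_left hwork (by linarith)
    have a2 : Q * q ≤ R * q := mul_le_mul_of_nonneg_right hQR hq0
    have a3 : R * (m / 2 * q + 1 / 2 * D) ≤ R * (m * S'.cost I) :=
      mul_le_mul_of_nonneg_left hopt hR0.le
    have a4 : ((m : ℝ) - 1) * (Q - R / 2) * q ≤ ((m : ℝ) - 1) * (Q - R / 2) * S'.cost I :=
      mul_le_mul_of_nonneg_left hopt' (mul_nonneg (by linarith) (by linarith))
    linarith
  have hrat : ratio α m * S'.cost I = ((R * (m + 1) / 2 + Q * (m - 1)) * S'.cost I) / m := by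
    rw [ratio, ← hR, ← hQ]
    field_simp
  rw [hrat, le_div_iff₀ (by linarith)]
  linarith

end IsThreePhase

end Schedule

end SEU

/-- An element of a nonempty finite set at which `f` is minimal. -/
noncomputable def Finset.argminOn {ι : Type*} (s : Finset ι) (hs : s.Nonempty) (f : ι → ℝ) : ι :=
  Classical.choose (s.exists_min_image f hs)

theorem Finset.argminOn_mem {ι : Type*} (s : Finset ι) (hs : s.Nonempty) (f : ι → ℝ) :
    s.argminOn hs f ∈ s := (Classical.choose_spec (s.exists_min_image f hs)).1

theorem Finset.apply_argminOn_le {ι : Type*} (s : Finset ι) (hs : s.Nonempty) (f : ι → ℝ) {x : ι}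
    (hx : x ∈ s) : f (s.argminOn hs f) ≤ f x :=
  (Classical.choose_spec (s.exists_min_image f hs)).2 x hx

theorem Finset.argminOn_congr {ι : Type*} (s : Finset ι) (hs : s.Nonempty) {f g : ι → ℝ}
    (h : ∀ x ∈ s, f x = g x) : s.argminOn hs f = s.argminOn hs g := by
  have : (fun x => x ∈ s ∧ ∀ y ∈ s, f x ≤ f y) = fun x => x ∈ s ∧ ∀ y ∈ s, g x ≤ g y := by
    funext x
    refine propext (and_congr_right fun hx => forall₂_congr fun y hy => ?_)
    rw [h x hx, h y hy]
  unfold Finset.argminOn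
  congr 1

/-- Start times and machines of a set of tasks, and the times at which the machines have run all
of them. -/
structure ListSchedule (ι κ : Type*) where
  start : ι → ℝ
  machine : ι → κ
  load : κ → ℝ

namespace ListSchedule

variable {ι κ : Type*}

/-- `G` is a greedy schedule of the tasks `s` with release times `r`, lengths `d` and priorities
`k` (smallest first), if machine `i` is available from time `ℓ i`. -/
structure IsGreedy (r d k : ι → ℝ) (s : Finset ι) (ℓ : κ → ℝ) (G : ListSchedule ι κ) : Prop where
  release_le : ∀ x ∈ s, r x ≤ G.start x
  load_le_start : ∀ x ∈ s, ℓ (G.machine x) ≤ G.start x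
  finish_le_load : ∀ x ∈ s, G.start x + d x ≤ G.load (G.machine x)
  le_load : ∀ i, ℓ i ≤ G.load i
  start_le_load : (∀ x ∈ s, ∀ i, r x ≤ ℓ i) → ∀ x ∈ s, ∀ i, G.start x ≤ G.load i
  no_overlap : ∀ x ∈ s, ∀ y ∈ s, x ≠ y → G.machine x = G.machine y →
    G.start x + d x ≤ G.start y ∨ G.start y + d y ≤ G.start x
  busy_of_waiting : ∀ x ∈ s, ∀ τ, r x ≤ τ → τ < G.start x → ∀ i,
    τ < ℓ i ∨ ∃ y ∈ s, G.machine y = i ∧ G.start y ≤ τ ∧ τ < G.start y + d y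
  busy_of_lt_load : ∀ i τ, τ < G.load i → (∀ x ∈ s, r x ≤ τ) →
    τ < ℓ i ∨ ∃ y ∈ s, G.machine y = i ∧ G.start y ≤ τ ∧ τ < G.start y + d y
  priority : ∀ x ∈ s, ∀ y ∈ s, k x < k y → r x ≤ G.start y → G.start x ≤ G.start y

section first

variable (r d k : ι → ℝ)

theorem isGreedy_empty [Nonempty κ] (ℓ : κ → ℝ) :
    (⟨fun _ => 0, fun _ => Classical.arbitrary κ, ℓ⟩ : ListSchedule ι κ).IsGreedy r d k ∅ ℓ := by
  constructor <;> simp_all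

variable [Fintype κ] [Nonempty κ]

/-- The machine that is available first. -/
noncomputable def firstMachine (ℓ : κ → ℝ) : κ :=
  Finset.univ.argminOn Finset.univ_nonempty ℓ

/-- The first time at which a task can be started. -/
noncomputable def firstTime (s : Finset ι) (hs : s.Nonempty) (ℓ : κ → ℝ) : ℝ :=
  max (ℓ (firstMachine ℓ)) (r (s.argminOn hs r))

theorem filter_le_firstTime_nonempty (s : Finset ι) (hs : s.Nonempty) (ℓ : κ → ℝ) :
    (s.filter fun x => r x ≤ firstTime r s hs ℓ).Nonempty :=
  ⟨_, Finset.mem_filter.2 ⟨s.argminOn_mem hs r, le_max_right _ _⟩⟩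

/-- The task that is started first. -/
noncomputable def firstTask (s : Finset ι) (hs : s.Nonempty) (ℓ : κ → ℝ) : ι :=
  (s.filter fun x => r x ≤ firstTime r s hs ℓ).argminOn
    (filter_le_firstTime_nonempty r s hs ℓ) k

theorem firstMachine_le (ℓ : κ → ℝ) (i : κ) : ℓ (firstMachine ℓ) ≤ ℓ i :=
  Finset.apply_argminOn_le _ _ _ (Finset.mem_univ i)

variable {r k} in
theorem firstTask_mem {s : Finset ι} (hs : s.Nonempty) (ℓ : κ → ℝ) : firstTask r k s hs ℓ ∈ s :=
  (Finset.mem_filter.1 (Finset.argminOn_mem _ _ _)).1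

variable {r k} in
theorem release_firstTask_le {s : Finset ι} (hs : s.Nonempty) (ℓ : κ → ℝ) :
    r (firstTask r k s hs ℓ) ≤ firstTime r s hs ℓ :=
  (Finset.mem_filter.1 (Finset.argminOn_mem (s.filter fun x => r x ≤ firstTime r s hs ℓ) _ _)).2

variable {r d k} in
theorem IsGreedy.firstTime_le {s : Finset ι} {ℓ : κ → ℝ} {G : ListSchedule ι κ}
    (h : G.IsGreedy r d k s ℓ) (hs : s.Nonempty) {x : ι} (hx : x ∈ s) :
    firstTime r s hs ℓ ≤ G.start x :=
  max_le ((firstMachine_le ℓ _).trans (h.load_le_start x hx))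
    ((Finset.apply_argminOn_le _ _ _ hx).trans (h.release_le x hx))

end first

variable [DecidableEq ι] [DecidableEq κ]

/-- Put the task `x` of length `d` in front: it is started at time `τ` on machine `i`. -/
def cons (x : ι) (τ : ℝ) (i : κ) (G : ListSchedule ι κ) : ListSchedule ι κ where
  start := Function.update G.start x τ
  machine := Function.update G.machine x i
  load := G.load

theorem IsGreedy.cons {r d k : ι → ℝ} {s : Finset ι} {ℓ : κ → ℝ} {G : ListSchedule ι κ} {x : ι}
    {τ : ℝ} {i : κ} (hd : ∀ y ∈ s, 0 ≤ d y) (hx : x ∈ s) (hr : r x ≤ τ)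
    (hk : ∀ y ∈ s, r y ≤ τ → k x ≤ k y) (hi : ∀ i', ℓ i ≤ ℓ i') (hℓ : ℓ i ≤ τ)
    (hτ : τ ≤ ℓ i ∨ ∀ y ∈ s, τ ≤ r y)
    (h : G.IsGreedy r d k (s.erase x) (Function.update ℓ i (τ + d x))) :
    (G.cons x τ i).IsGreedy r d k s ℓ := by
  have hdx := hd x hx
  have hup : ∀ i', ℓ i' ≤ Function.update ℓ i (τ + d x) i' := by
    intro i'
    by_cases e : i' = i
    · subst e
      rw [Function.update_self]
      linarith
    · rw [Function.update_of_ne e]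
  have hupi : Function.update ℓ i (τ + d x) i = τ + d x := Function.update_self ..
  have s0 : (G.cons x τ i).start x = τ := Function.update_self ..
  have m0 : (G.cons x τ i).machine x = i := Function.update_self ..
  have s1 : ∀ y, y ≠ x → (G.cons x τ i).start y = G.start y := fun y hy =>
    Function.update_of_ne hy ..
  have m1 : ∀ y, y ≠ x → (G.cons x τ i).machine y = G.machine y := fun y hy =>
    Function.update_of_ne hy ..
  have mem : ∀ {y}, y ∈ s → y ≠ x → y ∈ s.erase x := fun hy hne => Finset.mem_erase.2 ⟨hne, hy⟩
  have hfirst : ∀ y ∈ s, y ≠ x → τ ≤ G.start y := by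
    intro y hy hne
    have h1 := h.release_le y (mem hy hne)
    have h2 := h.load_le_start y (mem hy hne)
    have h3 := hup (G.machine y)
    have h4 := hi (G.machine y)
    rcases hτ with e | e
    · linarith
    · linarith [e y hy]
  have cover : ∀ {τ' i'}, (∃ y ∈ s, r y ≤ τ') →
      (τ' < Function.update ℓ i (τ + d x) i' ∨
        ∃ y ∈ s.erase x, G.machine y = i' ∧ G.start y ≤ τ' ∧ τ' < G.start y + d y) →
      τ' < ℓ i' ∨ ∃ y ∈ s, (G.cons x τ i).machine y = i' ∧ (G.cons x τ i).start y ≤ τ' ∧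
        τ' < (G.cons x τ i).start y + d y := by
    rintro τ' i' ⟨z, hz, hzr⟩ (hlt | ⟨y, hy, hym, hys, hyf⟩)
    · by_cases e : i' = i
      · subst e
        rw [hupi] at hlt
        by_cases h' : τ ≤ τ'
        · exact .inr ⟨x, hx, m0, by rwa [s0], by rwa [s0]⟩
        · refine .inl ?_
          rcases hτ with e | e
          · linarith
          · linarith [e z hz]
      · rw [Function.update_of_ne e] at hlt
        exact .inl hlt
    · obtain ⟨hne, hys'⟩ := Finset.mem_erase.1 hy
      exact .inr ⟨y, hys', by rwa [m1 y hne], by rwa [s1 y hne], by rwa [s1 y hne]⟩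
  constructor
  · intro y hy
    by_cases e : y = x
    · rw [e, s0]
      exact hr
    · rw [s1 y e]
      exact h.release_le y (mem hy e)
  · intro y hy
    by_cases e : y = x
    · rw [e, s0, m0]
      exact hℓ
    · rw [s1 y e, m1 y e]
      exact (hup _).trans (h.load_le_start y (mem hy e))
  · intro y hy
    by_cases e : y = x
    · rw [e, s0, m0, ← hupi]
      exact h.le_load i
    · rw [s1 y e, m1 y e]
      exact h.finish_le_load y (mem hy e)
  · exact fun i' => (hup i').trans (h.le_load i')
  · intro hall y hy i'
    by_cases e : y = x
    · rw [e, s0]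
      refine le_trans ?_ ((hup i').trans (h.le_load i'))
      rcases hτ with e | e
      · exact e.trans (hi i')
      · exact (e x hx).trans (hall x hx i')
    · rw [s1 y e]
      exact h.start_le_load (fun z hz i'' => (hall z (Finset.mem_of_mem_erase hz) i'').trans
        (hup i'')) y (mem hy e) i'
  · have main : ∀ y ∈ s, y ≠ x → i = G.machine y → τ + d x ≤ G.start y := by
      intro y hy hne e
      have := h.load_le_start y (mem hy hne)
      rwa [← e, hupi] at this
    intro y hy z hz hne hm
    by_cases e : y = x
    · subst e
      rw [m0, m1 z hne.symm] at hm
      rw [s0, s1 z hne.symm]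
      exact .inl (main z hz hne.symm hm)
    · by_cases e' : z = x
      · subst e'
        rw [m0, m1 y e] at hm
        rw [s0, s1 y e]
        exact .inr (main y hy e hm.symm)
      · rw [m1 y e, m1 z e'] at hm
        rw [s1 y e, s1 z e']
        exact h.no_overlap y (mem hy e) z (mem hz e') hne hm
  · intro y hy τ' hτr hτs i'
    by_cases e : y = x
    · subst e
      rw [s0] at hτs
      refine .inl ?_
      rcases hτ with e | e
      · linarith [hi i']
      · linarith [e y hy]
    · rw [s1 y e] at hτs
      exact cover ⟨y, hy, hτr⟩ (h.busy_of_waiting y (mem hy e) τ' hτr hτs i')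
  · intro i' τ' hlt hall
    exact cover ⟨x, hx, hall x hx⟩
      (h.busy_of_lt_load i' τ' hlt fun z hz => hall z (Finset.mem_of_mem_erase hz))
  · intro y hy z hz hlt hle
    by_cases e' : z = x
    · subst e'
      rw [s0] at hle
      exact absurd (hk y hy hle) hlt.not_ge
    · rw [s1 z e'] at hle ⊢
      by_cases e : y = x
      · rw [e, s0]
        exact hfirst z hz e'
      · rw [s1 y e]
        exact h.priority y (mem hy e) z (mem hz e') hlt hle

section run

variable [Fintype κ] [Nonempty κ] (r d k : ι → ℝ)

/-- The greedy schedule of (at most `N` of) the tasks in `s`. -/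
noncomputable def run : ℕ → Finset ι → (κ → ℝ) → ListSchedule ι κ
  | 0, _, ℓ => ⟨fun _ => 0, fun _ => Classical.arbitrary κ, ℓ⟩
  | N + 1, s, ℓ =>
    if hs : s.Nonempty then
      (run N (s.erase (firstTask r k s hs ℓ)) (Function.update ℓ (firstMachine ℓ)
        (firstTime r s hs ℓ + d (firstTask r k s hs ℓ)))).cons
        (firstTask r k s hs ℓ) (firstTime r s hs ℓ) (firstMachine ℓ)
    else ⟨fun _ => 0, fun _ => Classical.arbitrary κ, ℓ⟩

theorem run_isGreedy (N : ℕ) (s : Finset ι) (ℓ : κ → ℝ) (hN : s.card ≤ N)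
    (hd : ∀ x ∈ s, 0 ≤ d x) : (run r d k N s ℓ).IsGreedy r d k s ℓ := by
  induction N generalizing s ℓ with
  | zero =>
    obtain rfl : s = ∅ := Finset.card_eq_zero.1 (Nat.le_zero.1 hN)
    exact isGreedy_empty r d k ℓ
  | succ N ih =>
    by_cases hs : s.Nonempty
    · rw [run, dif_pos hs]
      have hmem := firstTask_mem (r := r) (k := k) hs ℓ
      refine IsGreedy.cons hd hmem (release_firstTask_le hs ℓ) ?_ (firstMachine_le ℓ)
        (le_max_left _ _) ?_ (ih _ _ ?_ fun x hx => hd x (Finset.mem_of_mem_erase hx))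
      · exact fun y hy hry => Finset.apply_argminOn_le _ _ _ (Finset.mem_filter.2 ⟨hy, hry⟩)
      · rcases max_choice (ℓ (firstMachine ℓ)) (r (s.argminOn hs r)) with e | e
        · exact .inl e.le
        · refine .inr fun y hy => ?_
          rw [firstTime, e]
          exact Finset.apply_argminOn_le _ _ _ hy
      · rw [Finset.card_erase_of_mem hmem]
        omega
    · rw [run, dif_neg hs]
      rw [Finset.not_nonempty_iff_eq_empty.1 hs]
      exact isGreedy_empty r d k ℓ

/-- The decisions of a greedy schedule up to time `τ` depend only on the tasks that are released
at time `τ` or earlier. -/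
theorem run_nonanticipating {d d' k k' : ι → ℝ} {τ : ℝ} (N : ℕ) (s : Finset ι) (ℓ : κ → ℝ)
    (hN : s.card ≤ N) (hd : ∀ x ∈ s, 0 ≤ d x) (hd' : ∀ x ∈ s, 0 ≤ d' x)
    (hdd : ∀ x ∈ s, r x ≤ τ → d x = d' x) (hkk : ∀ x ∈ s, r x ≤ τ → k x = k' x) :
    ∀ x ∈ s, ((run r d k N s ℓ).start x ≤ τ ∨ (run r d' k' N s ℓ).start x ≤ τ) →
      (run r d k N s ℓ).start x = (run r d' k' N s ℓ).start x ∧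
      (run r d k N s ℓ).machine x = (run r d' k' N s ℓ).machine x := by
  induction N generalizing s ℓ with
  | zero =>
    obtain rfl : s = ∅ := Finset.card_eq_zero.1 (Nat.le_zero.1 hN)
    simp
  | succ N ih =>
    intro x hx hxτ
    have hs : s.Nonempty := ⟨x, hx⟩
    have hτ : firstTime r s hs ℓ ≤ τ := by
      rcases hxτ with h | h
      · exact ((run_isGreedy r d k _ s ℓ hN hd).firstTime_le hs hx).trans h
      · exact ((run_isGreedy r d' k' _ s ℓ hN hd').firstTime_le hs hx).trans h
    have htask : firstTask r k s hs ℓ = firstTask r k' s hs ℓ := by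
      refine Finset.argminOn_congr _ _ fun y hy => ?_
      obtain ⟨hy, hyr⟩ := Finset.mem_filter.1 hy
      exact hkk y hy (hyr.trans hτ)
    have hmem := firstTask_mem (r := r) (k := k) hs ℓ
    have hdur := hdd _ hmem ((release_firstTask_le hs ℓ).trans hτ)
    simp only [run, dif_pos hs, ← htask, ← hdur] at hxτ ⊢
    by_cases e : x = firstTask r k s hs ℓ
    · simp [cons, ← e]
    · simp only [cons, Function.update_of_ne e] at hxτ ⊢
      refine ih _ _ ?_ (fun y hy => hd y (Finset.mem_of_mem_erase hy))
        (fun y hy => hd' y (Finset.mem_of_mem_erase hy))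
        (fun y hy => hdd y (Finset.mem_of_mem_erase hy))
        (fun y hy => hkk y (Finset.mem_of_mem_erase hy)) x (Finset.mem_erase.2 ⟨e, hx⟩) hxτ
      rw [Finset.card_erase_of_mem hmem]
      omega

end run

end ListSchedule

namespace SEU

namespace ThreePhase

variable {n m : ℕ} [Nonempty (Fin m)] (α : ℝ) (t u p : Fin n → ℝ)

/-- The untested executions and the tests. -/
noncomputable def earlyTasks : Finset (Task n) := by
  classical
  exact Finset.univ.filter fun
    | .test j => α * t j ≤ u j
    | .exec j => ¬ α * t j ≤ u j

/-- The executions of tested jobs. -/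
noncomputable def lateTasks : Finset (Task n) := by
  classical
  exact Finset.univ.filter fun
    | .test _ => False
    | .exec j => α * t j ≤ u j

@[simp] theorem test_mem_earlyTasks (j : Fin n) :
    .test j ∈ earlyTasks α t u ↔ α * t j ≤ u j := by simp [earlyTasks]

@[simp] theorem exec_mem_earlyTasks (j : Fin n) :
    .exec j ∈ earlyTasks α t u ↔ ¬ α * t j ≤ u j := by simp [earlyTasks]

@[simp] theorem test_mem_lateTasks (j : Fin n) : ¬ .test j ∈ lateTasks α t u := by
  simp [lateTasks]

@[simp] theorem exec_mem_lateTasks (j : Fin n) :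
    .exec j ∈ lateTasks α t u ↔ α * t j ≤ u j := by simp [lateTasks]

/-- The lengths of the untested executions and the tests. -/
def earlyDur : Task n → ℝ
  | .test j => t j
  | .exec j => u j

/-- The priorities of the untested executions and the tests. -/
def earlyKey : Task n → ℝ
  | .test j => α * t j
  | .exec j => u j

/-- The lengths of the executions of the tested jobs. -/
def lateDur : Task n → ℝ
  | .test _ => 0
  | .exec j => p j

/-- The greedy schedule of the untested executions and the tests. -/
noncomputable def early (m : ℕ) [Nonempty (Fin m)] : ListSchedule (Task n) (Fin m) :=
  .run (fun _ => 0) (earlyDur t u) (earlyKey α t u) (earlyTasks α t u).card (earlyTasks α t u)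
    fun _ => 0

/-- The finishing time of the test of a job. -/
noncomputable def release (m : ℕ) [Nonempty (Fin m)] : Task n → ℝ
  | .test _ => 0
  | .exec j => (early α t u m).start (.test j) + t j

/-- The greedy schedule of the executions of the tested jobs, after all other tasks. -/
noncomputable def late (m : ℕ) [Nonempty (Fin m)] : ListSchedule (Task n) (Fin m) :=
  .run (release α t u m) (lateDur p) (lateDur p) (lateTasks α t u).card (lateTasks α t u)
    (early α t u m).load

open Classical in
/-- The schedule of the three-phase algorithm. -/
noncomputable def schedule (m : ℕ) [Nonempty (Fin m)] : Schedule n m where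
  tested j := decide (α * t j ≤ u j)
  start x := if x ∈ earlyTasks α t u then (early α t u m).start x else (late α t u p m).start x
  machine x :=
    if x ∈ earlyTasks α t u then (early α t u m).machine x else (late α t u p m).machine x

variable {t u p}

theorem early_isGreedy (ht : ∀ j, 0 ≤ t j) (hu : ∀ j, 0 ≤ u j) :
    (early α t u m).IsGreedy (fun _ => 0) (earlyDur t u) (earlyKey α t u) (earlyTasks α t u)
      fun _ => 0 :=
  ListSchedule.run_isGreedy _ _ _ _ _ _ le_rfl fun x _ => by
    cases x
    exacts [ht _, hu _]

theorem lateDur_nonneg (hp : ∀ j, 0 ≤ p j) (x : Task n) : 0 ≤ lateDur p x := by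
  cases x
  exacts [le_rfl, hp _]

theorem late_isGreedy (hp : ∀ j, 0 ≤ p j) :
    (late α t u p m).IsGreedy (release α t u m) (lateDur p) (lateDur p) (lateTasks α t u)
      (early α t u m).load :=
  ListSchedule.run_isGreedy _ _ _ _ _ _ le_rfl fun x _ => lateDur_nonneg hp x

section

variable {α} {I : Instance n}

theorem tested_iff (j : Fin n) :
    (schedule α t u p m).tested j = true ↔ α * t j ≤ u j := by simp [schedule]

theorem mem_or_mem {x : Task n} (hx : (schedule α t u p m).Occurs x) :
    x ∈ earlyTasks α t u ∨ x ∈ lateTasks α t u := by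
  cases x with
  | test j => exact .inl (by simpa [Schedule.Occurs, schedule] using hx)
  | exec j =>
    by_cases h : α * t j ≤ u j
    · exact .inr (by simpa using h)
    · exact .inl (by simpa using h)

theorem occurs_of_mem_early {x : Task n} (hx : x ∈ earlyTasks α t u) :
    (schedule α t u p m).Occurs x := by
  cases x with
  | test j => simpa [Schedule.Occurs, schedule] using hx
  | exec j => trivial

theorem occurs_of_mem_late {x : Task n} (hx : x ∈ lateTasks α t u) :
    (schedule α t u p m).Occurs x := by
  cases x with
  | test j => simp at hx
  | exec j => trivial

theorem not_mem_early {x : Task n} (hx : x ∈ lateTasks α t u) : x ∉ earlyTasks α t u := by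
  cases x <;> simp_all

theorem start_of_mem_early {x : Task n} (hx : x ∈ earlyTasks α t u) :
    (schedule α t u p m).start x = (early α t u m).start x := if_pos hx

theorem start_of_mem_late {x : Task n} (hx : x ∈ lateTasks α t u) :
    (schedule α t u p m).start x = (late α t u p m).start x := if_neg (not_mem_early hx)

theorem machine_of_mem_early {x : Task n} (hx : x ∈ earlyTasks α t u) :
    (schedule α t u p m).machine x = (early α t u m).machine x := if_pos hx

theorem machine_of_mem_late {x : Task n} (hx : x ∈ lateTasks α t u) :
    (schedule α t u p m).machine x = (late α t u p m).machine x := if_neg (not_mem_early hx)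

theorem dur_of_mem_early {x : Task n} (hx : x ∈ earlyTasks α I.t I.u) :
    (schedule α I.t I.u p m).dur I x = earlyDur I.t I.u x := by
  cases x with
  | test j => rfl
  | exec j =>
    rw [exec_mem_earlyTasks] at hx
    simp [Schedule.dur, schedule, earlyDur, hx]

theorem dur_of_mem_late {x : Task n} (hx : x ∈ lateTasks α I.t I.u) :
    (schedule α I.t I.u p m).dur I x = lateDur I.p x := by
  cases x with
  | test j => simp at hx
  | exec j =>
    rw [exec_mem_lateTasks] at hx
    simp [Schedule.dur, schedule, lateDur, hx]

theorem phase_of_mem_late {x : Task n} (hx : x ∈ lateTasks α t u) :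
    (schedule α t u p m).phase x = 2 := by
  cases x with
  | test j => simp at hx
  | exec j => exact if_pos ((tested_iff j).2 (by simpa using hx))

theorem phase_exec_of_mem_early {j : Fin n} (hx : .exec j ∈ earlyTasks α t u) :
    (schedule α t u p m).phase (.exec j) = 0 :=
  if_neg (by rw [tested_iff]; simpa using hx)

theorem phase_lt_of_mem_early {x : Task n} (hx : x ∈ earlyTasks α t u) :
    (schedule α t u p m).phase x < 2 := by
  cases x with
  | test j => exact one_lt_two
  | exec j =>
    rw [phase_exec_of_mem_early hx]
    exact two_pos

theorem earlyKey_lt_of_precedes (hI : I.Uniform) {x y : Task n}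
    (hx : x ∈ earlyTasks α I.t I.u) (hy : y ∈ earlyTasks α I.t I.u)
    (h : (schedule α I.t I.u p m).Precedes I x y) :
    earlyKey α I.t I.u x < earlyKey α I.t I.u y := by
  rw [Schedule.Precedes, dur_of_mem_early hx, dur_of_mem_early hy] at h
  cases x with
  | test i =>
    cases y with
    | test j => simp [Schedule.phase, earlyDur, hI i j] at h
    | exec j =>
      rw [phase_exec_of_mem_early hy] at h
      simp [Schedule.phase] at h
  | exec i =>
    cases y with
    | test j =>
      rw [exec_mem_earlyTasks, not_le, hI i j] at hx
      exact hx
    | exec j =>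
      rw [phase_exec_of_mem_early hx, phase_exec_of_mem_early hy] at h
      simpa [earlyKey, earlyDur] using h

theorem finish_of_mem_early {x : Task n} (hx : x ∈ earlyTasks α I.t I.u) :
    (schedule α I.t I.u p m).finish I x = (early α I.t I.u m).start x + earlyDur I.t I.u x := by
  rw [Schedule.finish, dur_of_mem_early hx, start_of_mem_early hx]

theorem finish_of_mem_late {x : Task n} (hx : x ∈ lateTasks α I.t I.u) :
    (schedule α I.t I.u p m).finish I x = (late α I.t I.u p m).start x + lateDur I.p x := by
  rw [Schedule.finish, dur_of_mem_late hx, start_of_mem_late hx]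

theorem avail_of_mem_early {x : Task n} (hx : x ∈ earlyTasks α I.t I.u) :
    (schedule α I.t I.u p m).avail I x = 0 := by
  cases x with
  | test j => rfl
  | exec j =>
    rw [exec_mem_earlyTasks] at hx
    simp [Schedule.avail, schedule, hx]

theorem avail_of_mem_late {x : Task n} (hx : x ∈ lateTasks α I.t I.u) :
    (schedule α I.t I.u p m).avail I x = release α I.t I.u m x := by
  cases x with
  | test j => simp at hx
  | exec j =>
    rw [exec_mem_lateTasks] at hx
    have h : (schedule α I.t I.u p m).tested j = true := (tested_iff j).2 hx
    simp only [Schedule.avail, h, if_true]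
    rw [finish_of_mem_early ((test_mem_earlyTasks α I.t I.u j).2 hx)]
    rfl

end

variable (I : Instance n)

theorem early_start_nonneg {x : Task n} (hx : x ∈ earlyTasks α I.t I.u) :
    0 ≤ (early α I.t I.u m).start x :=
  (early_isGreedy α I.t_nonneg I.u_nonneg).release_le x hx

theorem load_nonneg (i : Fin m) : 0 ≤ (early α I.t I.u m).load i :=
  (early_isGreedy α I.t_nonneg I.u_nonneg).le_load i

theorem early_start_le_late_start {x y : Task n} (hx : x ∈ earlyTasks α I.t I.u)
    (hy : y ∈ lateTasks α I.t I.u) :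
    (early α I.t I.u m).start x ≤ (late α I.t I.u I.p m).start y :=
  ((early_isGreedy α I.t_nonneg I.u_nonneg).start_le_load (fun _ _ _ => le_rfl) x hx _).trans
    ((late_isGreedy α I.p_nonneg).load_le_start y hy)

theorem early_finish_le_late_start {x y : Task n} (hx : x ∈ earlyTasks α I.t I.u)
    (hy : y ∈ lateTasks α I.t I.u)
    (h : (early α I.t I.u m).machine x = (late α I.t I.u I.p m).machine y) :
    (early α I.t I.u m).start x + earlyDur I.t I.u x ≤ (late α I.t I.u I.p m).start y := by
  refine ((early_isGreedy α I.t_nonneg I.u_nonneg).finish_le_load x hx).trans ?_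
  rw [h]
  exact (late_isGreedy α I.p_nonneg).load_le_start y hy

theorem schedule_feasible : (schedule α I.t I.u I.p m).Feasible I where
  start_nonneg x hx := by
    rcases mem_or_mem hx with h | h
    · rw [start_of_mem_early h]
      exact early_start_nonneg α I h
    · rw [start_of_mem_late h]
      exact (load_nonneg α I _).trans ((late_isGreedy α I.p_nonneg).load_le_start x h)
  avail_le_start x hx := by
    rcases mem_or_mem hx with h | h
    · rw [start_of_mem_early h, avail_of_mem_early h]
      exact early_start_nonneg α I h
    · rw [start_of_mem_late h, avail_of_mem_late h]
      exact (late_isGreedy α I.p_nonneg).release_le x h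
  no_overlap x y hx hy hne hm := by
    rcases mem_or_mem hx with h | h <;> rcases mem_or_mem hy with h' | h'
    · rw [machine_of_mem_early h, machine_of_mem_early h'] at hm
      rw [start_of_mem_early h, start_of_mem_early h', finish_of_mem_early h,
        finish_of_mem_early h']
      exact (early_isGreedy α I.t_nonneg I.u_nonneg).no_overlap x h y h' hne hm
    · rw [machine_of_mem_early h, machine_of_mem_late h'] at hm
      rw [start_of_mem_late h', finish_of_mem_early h]
      exact .inl (early_finish_le_late_start α I h h' hm)
    · rw [machine_of_mem_late h, machine_of_mem_early h'] at hm
      rw [start_of_mem_late h, finish_of_mem_early h']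
      exact .inr (early_finish_le_late_start α I h' h hm.symm)
    · rw [machine_of_mem_late h, machine_of_mem_late h'] at hm
      rw [start_of_mem_late h, start_of_mem_late h', finish_of_mem_late h, finish_of_mem_late h']
      exact (late_isGreedy α I.p_nonneg).no_overlap x h y h' hne hm

theorem busy_of_early {i : Fin m} {τ : ℝ} (h : ∃ y ∈ earlyTasks α I.t I.u,
    (early α I.t I.u m).machine y = i ∧ (early α I.t I.u m).start y ≤ τ ∧
      τ < (early α I.t I.u m).start y + earlyDur I.t I.u y) :
    (schedule α I.t I.u I.p m).Busy I i τ := by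
  obtain ⟨y, hy, h1, h2, h3⟩ := h
  exact ⟨y, occurs_of_mem_early hy, by rwa [machine_of_mem_early hy],
    by rwa [start_of_mem_early hy], by rwa [finish_of_mem_early hy]⟩

theorem schedule_isThreePhase (hI : I.Uniform) :
    (schedule α I.t I.u I.p m).IsThreePhase α I where
  feasible := schedule_feasible α I
  tested_iff := tested_iff
  greedy x hx τ hτ hlt i := by
    have hA := early_isGreedy (m := m) α I.t_nonneg I.u_nonneg
    rcases mem_or_mem hx with h | h
    · rw [avail_of_mem_early h] at hτ
      rw [start_of_mem_early h] at hlt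
      rcases hA.busy_of_waiting x h τ hτ hlt i with h' | h'
      · exact absurd h' hτ.not_gt
      · exact busy_of_early α I h'
    · rw [avail_of_mem_late h] at hτ
      rw [start_of_mem_late h] at hlt
      rcases (late_isGreedy α I.p_nonneg).busy_of_waiting x h τ hτ hlt i with h' | h'
      · have hτ0 : 0 ≤ τ := by
          refine le_trans ?_ hτ
          cases x with
          | test j => exact le_rfl
          | exec j =>
            refine add_nonneg (early_start_nonneg α I ?_) (I.t_nonneg j)
            simpa using h
        rcases hA.busy_of_lt_load i τ h' fun _ _ => hτ0 with h'' | h''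
        · exact absurd h'' hτ0.not_gt
        · exact busy_of_early α I h''
      · obtain ⟨y, hy, h1, h2, h3⟩ := h'
        exact ⟨y, occurs_of_mem_late hy, by rwa [machine_of_mem_late hy],
          by rwa [start_of_mem_late hy], by rwa [finish_of_mem_late hy]⟩
  priority x y hx hy hxy hle := by
    rcases mem_or_mem hx with h | h <;> rcases mem_or_mem hy with h' | h'
    · rw [start_of_mem_early h, start_of_mem_early h']
      exact (early_isGreedy α I.t_nonneg I.u_nonneg).priority x h y h'
        (earlyKey_lt_of_precedes hI h h' hxy) (early_start_nonneg α I h')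
    · rw [start_of_mem_early h, start_of_mem_late h']
      exact early_start_le_late_start α I h h'
    · have h1 := phase_of_mem_late (m := m) (p := I.p) h
      have h2 := phase_lt_of_mem_early (m := m) (p := I.p) h'
      rcases hxy with h3 | h3 <;> omega
    · rw [avail_of_mem_late h, start_of_mem_late h'] at hle
      rw [start_of_mem_late h, start_of_mem_late h']
      refine (late_isGreedy α I.p_nonneg).priority x h y h' ?_ hle
      rw [Schedule.Precedes, phase_of_mem_late h, phase_of_mem_late h', dur_of_mem_late h,
        dur_of_mem_late h'] at hxy
      simpa using hxy

theorem schedule_nonanticipating {p p' : Fin n → ℝ} (hp : ∀ j, 0 ≤ p j) (hp' : ∀ j, 0 ≤ p' j)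
    {τ : ℝ} (h : ∀ j, α * t j ≤ u j → (early α t u m).start (.test j) + t j ≤ τ → p j = p' j) :
    (schedule α t u p m).AgreeUpTo τ (schedule α t u p' m) := by
  have hdur : ∀ x ∈ lateTasks α t u, release α t u m x ≤ τ → lateDur p x = lateDur p' x := by
    intro x hx hr
    cases x with
    | test j => rfl
    | exec j => exact h j (by simpa using hx) hr
  have key := ListSchedule.run_nonanticipating (release α t u m) (lateTasks α t u).card
    (lateTasks α t u) (early α t u m).load le_rfl (fun x _ => lateDur_nonneg hp x)
    (fun x _ => lateDur_nonneg hp' x) hdur hdur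
  have agree : ∀ x, (schedule α t u p m).Occurs x →
      (schedule α t u p m).start x ≤ τ ∨ (schedule α t u p' m).start x ≤ τ →
      (schedule α t u p m).start x = (schedule α t u p' m).start x ∧
      (schedule α t u p m).machine x = (schedule α t u p' m).machine x := by
    intro x hx hτ
    rcases mem_or_mem hx with hm | hm
    · rw [start_of_mem_early hm, start_of_mem_early hm, machine_of_mem_early hm,
        machine_of_mem_early hm]
      exact ⟨rfl, rfl⟩
    · rw [start_of_mem_late hm, start_of_mem_late hm] at hτ
      rw [start_of_mem_late hm, start_of_mem_late hm, machine_of_mem_late hm,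
        machine_of_mem_late hm]
      exact key x hm hτ
  have hocc : ∀ x, (schedule α t u p m).Occurs x ↔ (schedule α t u p' m).Occurs x := by
    intro x
    cases x <;> rfl
  refine ⟨fun x => ⟨fun hx => ?_, fun hx => ?_⟩, fun x hx => agree x hx.1 (.inl hx.2),
    fun j _ => rfl⟩
  · exact ⟨(hocc x).1 hx.1, (agree x hx.1 (.inl hx.2)).1 ▸ hx.2⟩
  · exact ⟨(hocc x).2 hx.1, (agree x ((hocc x).2 hx.1) (.inr hx.2)).1 ▸ hx.2⟩

/-- The three-phase algorithm. -/
noncomputable def algorithm (m : ℕ) [Nonempty (Fin m)] : OnlineAlgorithm m where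
  schedule I := schedule α I.t I.u I.p m
  feasible := schedule_feasible α
  nonanticipating := by
    rintro n ⟨t, u, p, ht, hp, hpu⟩ ⟨t', u', p', ht', hp', hpu'⟩ τ rfl rfl h
    refine schedule_nonanticipating α hp hp' fun j hj hτ => h j ((tested_iff j).2 hj) ?_
    rw [Schedule.finish, start_of_mem_early (by simpa using hj)]
    exact hτ

theorem algorithm_isCompetitiveOnUniform (hm : 1 ≤ m) (hα : 1 ≤ α) :
    (algorithm α m).IsCompetitiveOnUniform (ratio α m) := by
  intro n I hI
  have h3 := schedule_isThreePhase (m := m) α I hI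
  have hm1 : (1 : ℝ) ≤ m := by exact_mod_cast hm
  have hρ : 0 < ratio α m := by
    have h1 : (1 : ℝ) / m ≤ 1 := by rw [div_le_one (by linarith)]; exact hm1
    have h2 : (2 : ℝ) ≤ max 2 (max α (1 + 2 / α)) := le_max_left _ _
    have h4 : (1 : ℝ) ≤ max α (1 + 1 / α) := hα.trans (le_max_left _ _)
    have h5 : (0 : ℝ) ≤ 1 / (2 * m) := by positivity
    exact add_pos_of_pos_of_nonneg (mul_pos (by linarith) (by linarith))
      (mul_nonneg (by linarith) (by linarith))
  rw [← div_le_iff₀' hρ]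
  refine le_csInf ⟨_, _, h3.feasible, rfl⟩ ?_
  rintro c ⟨S, hS, rfl⟩
  rw [div_le_iff₀' hρ]
  exact h3.cost_le hI hα hm hS

end ThreePhase

end SEU

namespace SEU

theorem one_add_two_div_goldenRatio : 1 + 2 / Real.goldenRatio = Real.sqrt 5 := by
  have h : 2 / Real.goldenRatio = 2 * Real.goldenRatio⁻¹ := by ring
  rw [h, Real.inv_goldenRatio, Real.goldenConj]
  ring

theorem one_add_one_div_goldenRatio : 1 + 1 / Real.goldenRatio = Real.goldenRatio := by
  rw [one_div, Real.inv_goldenRatio, Real.goldenConj, Real.goldenRatio]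
  ring

theorem ratio_goldenRatio (m : ℕ) :
    ratio Real.goldenRatio m = Real.sqrt 5 * (1 / 2 + 1 / (2 * (m : ℝ))) +
      Real.goldenRatio * (1 - 1 / (m : ℝ)) := by
  have h2 : (2 : ℝ) ≤ Real.sqrt 5 := Real.le_sqrt_of_sq_le (by norm_num)
  rw [ratio, one_add_two_div_goldenRatio, one_add_one_div_goldenRatio, max_self,
    max_eq_right (a := Real.goldenRatio), max_eq_right h2]
  rw [Real.goldenRatio]
  linarith

theorem tendsto_ratio_goldenRatio :
    Filter.Tendsto (fun m : ℕ => ratio Real.goldenRatio m) Filter.atTop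
      (nhds (1 / 2 + Real.sqrt 5)) := by
  have h := tendsto_one_div_atTop_nhds_zero_nat (𝕜 := ℝ)
  have h1 : Filter.Tendsto (fun m : ℕ => Real.sqrt 5 * (1 / 2 + 1 / 2 * (1 / (m : ℝ))) +
      Real.goldenRatio * (1 - 1 / (m : ℝ))) Filter.atTop
      (nhds (Real.sqrt 5 * (1 / 2 + 1 / 2 * 0) + Real.goldenRatio * (1 - 0))) :=
    (((h.const_mul _).const_add _).const_mul _).add ((h.const_sub _).const_mul _)
  have e : Real.sqrt 5 * (1 / 2 + 1 / 2 * 0) + Real.goldenRatio * (1 - 0) =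
      1 / 2 + Real.sqrt 5 := by
    rw [Real.goldenRatio]
    ring
  rw [e] at h1
  refine h1.congr fun m => ?_
  rw [ratio_goldenRatio, one_div_mul_one_div]

theorem ratio_goldenRatio_le {m : ℕ} (hm : 3 ≤ m) {α : ℝ} (hα : 1 ≤ α) :
    ratio Real.goldenRatio m ≤ ratio α m := by
  have hα0 : 0 < α := by linarith
  have hm3 : (3 : ℝ) ≤ m := by exact_mod_cast hm
  have hx : (1 : ℝ) / m ≤ 1 / 3 := one_div_le_one_div_of_le (by norm_num) hm3
  have hx0 : 0 ≤ (1 : ℝ) / m := by positivity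
  have hφ := Real.goldenRatio_pos
  have hR : 1 + 2 / α ≤ max 2 (max α (1 + 2 / α)) := (le_max_right _ _).trans (le_max_right _ _)
  rw [ratio_goldenRatio, ratio, ← one_div_mul_one_div]
  set x := (1 : ℝ) / m with hxdef
  have hc : 0 ≤ 1 / 2 + 1 / 2 * x := by linarith
  have hd : 0 ≤ 1 - x := by linarith
  rcases le_total α Real.goldenRatio with h | h
  · refine add_le_add (mul_le_mul_of_nonneg_right (le_trans ?_ hR) hc)
      (mul_le_mul_of_nonneg_right (le_trans ?_ (le_max_right _ _)) hd)
    · rw [← one_add_two_div_goldenRatio]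
      gcongr
    · rw [← one_add_one_div_goldenRatio]
      gcongr
  · have hQ : α ≤ max α (1 + 1 / α) := le_max_left _ _
    refine le_trans ?_ (add_le_add (mul_le_mul_of_nonneg_right hR hc)
      (mul_le_mul_of_nonneg_right hQ hd))
    rw [← one_add_two_div_goldenRatio]
    have hsq := Real.goldenRatio_sq
    have h1 : 2 / Real.goldenRatio - 2 / α ≤ α - Real.goldenRatio := by
      rw [div_sub_div _ _ hφ.ne' hα0.ne', div_le_iff₀ (mul_pos hφ hα0)]
      have : 2 ≤ Real.goldenRatio * α := by nlinarith [Real.one_lt_goldenRatio]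
      nlinarith
    have h2 : (2 / Real.goldenRatio - 2 / α) * (1 / 2 + 1 / 2 * x) ≤
        (α - Real.goldenRatio) * (1 / 2 + 1 / 2 * x) := mul_le_mul_of_nonneg_right h1 hc
    have h3 : (α - Real.goldenRatio) * (1 / 2 + 1 / 2 * x) ≤ (α - Real.goldenRatio) * (1 - x) :=
      mul_le_mul_of_nonneg_left (by linarith) (by linarith)
    linarith

theorem sInf_ratio {m : ℕ} (hm : 3 ≤ m) :
    sInf ((fun α : ℝ => ratio α m) '' Set.Ici 1) = ratio Real.goldenRatio m := by
  refine IsLeast.csInf_eq ⟨⟨_, Real.one_lt_goldenRatio.le, rfl⟩, ?_⟩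
  rintro _ ⟨α, hα, rfl⟩
  exact ratio_goldenRatio_le hm hα

end SEU

theorem mainTheorem6 :
    (∀ (m : ℕ) (α : ℝ), 1 ≤ m → 1 ≤ α →
      ∃ A : SEU.OnlineAlgorithm m,
        (∀ (n : ℕ) (I : SEU.Instance n), I.Uniform → (A.schedule I).IsThreePhase α I) ∧
        A.IsCompetitiveOnUniform (SEU.ratio α m)) ∧
    Filter.Tendsto (fun m : ℕ => SEU.ratio Real.goldenRatio m) Filter.atTop
      (nhds (1 / 2 + Real.sqrt 5)) ∧
    Filter.Tendsto (fun m : ℕ => sInf ((fun α : ℝ => SEU.ratio α m) '' Set.Ici 1)) Filter.atTop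
      (nhds (1 / 2 + Real.sqrt 5)) ∧
    (2.73606 : ℝ) < 1 / 2 + Real.sqrt 5 ∧ 1 / 2 + Real.sqrt 5 < (2.73607 : ℝ) := by
  refine ⟨fun m α hm hα => ?_, SEU.tendsto_ratio_goldenRatio, ?_, ?_, ?_⟩
  · have : Nonempty (Fin m) := ⟨⟨0, hm⟩⟩
    exact ⟨SEU.ThreePhase.algorithm α m,
      fun n I hI => SEU.ThreePhase.schedule_isThreePhase α I hI,
      SEU.ThreePhase.algorithm_isCompetitiveOnUniform α hm hα⟩
  · refine SEU.tendsto_ratio_goldenRatio.congr' ?_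
    filter_upwards [Filter.eventually_ge_atTop 3] with m hm
    exact (SEU.sInf_ratio hm).symm
  · have : (2.23606 : ℝ) < Real.sqrt 5 := Real.lt_sqrt_of_sq_lt (by norm_num)
    linarith
  · have : Real.sqrt 5 < 2.23607 := (Real.sqrt_lt' (by norm_num)).2 (by norm_num)
    linarith
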